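/- All trees are finite. A \emph{leaf} is a vertex of degree $1$; a \emph{$1$-$3$ tree} is a tree in which every vertex has degree $1$ or $3$; a tree is \emph{even} if all of its leaves lie in the same class of its unique bipartition. A \emph{leaf-leaf path} is a path whose two ends are leaves (a single leaf counts as a leaf-leaf path of length $0$), and its length is its number of edges. Then: (i) There is an integer $N_0$ such that every even $1$-$3$ tree $T$ with at least $N_0$ vertices contains leaf-leaf paths of each of the lengths $0, 2, 4, \dots, 18$. (ii) There is an infinite family $(T_n)_{n=1}^{\infty}$ of even $1$-$3$ trees, with $|V(T_1)| < |V(T_2)| < \cdots$, such that no $T_n$ contains a leaf-leaf path of length $20$. -/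

import Mathlib

namespace SimpleGraph

variable {V : Type*} (G : SimpleGraph V)

/-- A leaf is a vertex of degree `1`. -/
def IsLeafVertex [G.LocallyFinite] (v : V) : Prop :=
  G.degree v = 1

/-- All leaves lie in the same class of a bipartition of `G`. A tree has exactly one bipartition
(up to exchanging the two classes), so for trees this says that the leaves lie in the same class of
that bipartition. -/
def LeavesInOneClass [G.LocallyFinite] : Prop :=
  ∃ c : G.Coloring Bool, ∀ u v : V, G.IsLeafVertex u → G.IsLeafVertex v → c u = c v

/-- An even 1-3 tree: a tree in which every vertex has degree `1` or `3` and all leaves lie in the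
same class of the bipartition. -/
structure IsEvenOneThreeTree [G.LocallyFinite] : Prop where
  isTree : G.IsTree
  degree_eq : ∀ v : V, G.degree v = 1 ∨ G.degree v = 3
  even : G.LeavesInOneClass

/-- `G` contains a leaf-leaf path with exactly `ℓ` edges. The two end leaves may coincide, in which
case the path is trivial and `ℓ = 0`. -/
def HasLeafLeafPath [G.LocallyFinite] (ℓ : ℕ) : Prop :=
  ∃ (u v : V) (p : G.Walk u v),
    G.IsLeafVertex u ∧ G.IsLeafVertex v ∧ p.IsPath ∧ p.length = ℓ

end SimpleGraph

/-! Lower half: suppose there is no leaf-leaf path of length `2 * m`. Two branches at a vertex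
cannot both have a nearest leaf at depth `m - 1`, so recursion away from an edge finds a leaf at
depth less than `m` beyond every directed edge (`exists_leafBeyond_lt`). Now climb a path from a
leaf and record the leaf depths behind each vertex. Each side branch contributes some `j < m` of
prescribed parity, and `j` must not complete a depth already recorded to a path of length `2 * m`.
For `m ≤ 9` a finite search over the recorded sets dies out within 60 steps (`forcedDepths_sixty`),
so paths between leaves have bounded length; bounded degree then bounds the tree.

Upper half: hang a perfect binary tree of height `k t` at position `t` of a spine. Leaves over
positions `s < t` are at distance `k s + k t + (t - s)`, and leaves of one tree at distance at most
`2 * k t - 2`. A height sequence of period 24, bounded by 10, avoids the value 20; evenness means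
that `t + k t` is even. The family shows that the search for `m = 10` never dies out. -/

/-! ### The finite search over sets of leaf depths -/

/-- Insert `x` into `l`, keeping only entries whose sets of binary digits are minimal. -/
def insertMinimal (x : ℕ) (l : List ℕ) : List ℕ :=
  if l.any (fun y => y &&& x == y) then l else x :: l.filter (fun y => !(x &&& y == x))

/-- Sets of leaf depths, encoded by binary digits, that are forced below a vertex lying at distance
`h` above a leaf in a tree without leaf-leaf paths of length `2 * m`: for every such vertex one of
the listed sets occurs. -/
def forcedDepths (m : ℕ) : ℕ → List ℕ
  | 0 => [1]
  | h + 1 =>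
    ((forcedDepths m h).flatMap fun s => (List.range m).filterMap fun j =>
      -- Depths `i` and `j` in two branches give a path of length `i + j + 2`, so `j` clashes
      -- exactly with `2 * m - 2 - j`. Depths from `2 * m - 1` on clash with nothing and are cut
      -- off.
      if j % 2 == h % 2 && !(s.testBit (2 * m - 2 - j)) then
        some (((s ||| 1 <<< j) <<< 1) % 2 ^ (2 * m - 1))
      else none).foldr insertMinimal []

theorem forcedDepths_sixty : ∀ m ∈ List.range 10, forcedDepths m 60 = [] := by
  decide +kernel

theorem Nat.testBit_of_and_eq {x y k : ℕ} (h : y &&& x = y) (hk : y.testBit k) : x.testBit k := by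
  rw [← h, Nat.testBit_and] at hk
  exact (Bool.and_eq_true_iff.1 hk).2

/-- Pruning is sound: a smaller set records fewer forced leaves, so it is a weaker claim about the
tree and may replace any set containing it. -/
theorem exists_mem_foldr_insertMinimal {x : ℕ} {l : List ℕ} (hx : x ∈ l) :
    ∃ y ∈ l.foldr insertMinimal [], ∀ k, y.testBit k → x.testBit k := by
  induction l with
  | nil => simp at hx
  | cons a l ih =>
    rw [List.foldr_cons, insertMinimal]
    rcases List.mem_cons.1 hx with rfl | hx
    · split_ifs with h
      · obtain ⟨y, hy, hyx⟩ := List.any_eq_true.1 h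
        exact ⟨y, hy, fun k => Nat.testBit_of_and_eq (beq_iff_eq.1 hyx)⟩
      · exact ⟨x, List.mem_cons_self, fun _ h => h⟩
    · obtain ⟨y, hy, hyx⟩ := ih hx
      split_ifs with h
      · exact ⟨y, hy, hyx⟩
      · by_cases hay : a &&& y = a
        · exact ⟨a, List.mem_cons_self, fun k hk => hyx k (Nat.testBit_of_and_eq hay hk)⟩
        · exact ⟨y, List.mem_cons_of_mem _ (List.mem_filter.2 ⟨hy, by simpa using hay⟩), hyx⟩

theorem exists_mem_forcedDepths_succ {m h s j : ℕ} (hs : s ∈ forcedDepths m h) (hj : j < m)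
    (hpar : j % 2 = h % 2) (hsj : s.testBit (2 * m - 2 - j) = false) :
    ∃ t ∈ forcedDepths m (h + 1), ∀ k, t.testBit k → ∃ i, k = i + 1 ∧ (s.testBit i ∨ i = j) := by
  have hmem : ((s ||| 1 <<< j) <<< 1) % 2 ^ (2 * m - 1) ∈
      ((forcedDepths m h).flatMap fun s => (List.range m).filterMap fun j =>
      if j % 2 == h % 2 && !(s.testBit (2 * m - 2 - j)) then
        some (((s ||| 1 <<< j) <<< 1) % 2 ^ (2 * m - 1))
      else none) :=
    List.mem_flatMap.2 ⟨s, hs, List.mem_filterMap.2 ⟨j, List.mem_range.2 hj, by simp [hpar, hsj]⟩⟩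
  obtain ⟨t, ht, hts⟩ := exists_mem_foldr_insertMinimal hmem
  refine ⟨t, ht, fun k hk => ?_⟩
  have := hts k hk
  rw [Nat.testBit_mod_two_pow, Nat.testBit_shiftLeft, Nat.testBit_or, Nat.one_shiftLeft,
    Nat.testBit_two_pow] at this
  simp only [ge_iff_le, Bool.and_eq_true, decide_eq_true_eq, Bool.or_eq_true] at this
  exact ⟨k - 1, by omega, this.2.2.imp_right Eq.symm⟩

theorem forcedDepths_eq_nil {m h : ℕ} (hm : m ≤ 9) (hh : 60 ≤ h) : forcedDepths m h = [] := by
  induction h, hh using Nat.le_induction with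
  | base => exact forcedDepths_sixty m (List.mem_range.2 (by omega))
  | succ h _ ih => simp [forcedDepths, ih]

/-! ### Leaves beyond an edge in an acyclic graph -/

namespace SimpleGraph

variable {V : Type*} {G : SimpleGraph V}

/-- In an acyclic graph, two paths that leave a common vertex along different edges can be joined
to a path. -/
theorem IsAcyclic.exists_isPath_join (hG : G.IsAcyclic) {x y z : V} (p : G.Walk x y) :
    -- The trivial case is separate because `snd` of a trivial walk is its start, which lies on `q`.
    -- The induction moves the edges of `p` one by one to the front of `q`.
    ∀ q : G.Walk x z, p.IsPath → q.IsPath → (p.length = 0 ∨ p.snd ∉ q.support) →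
      ∃ r : G.Walk y z, r.IsPath ∧ r.length = p.length + q.length := by
  induction p with
  | nil => exact fun q _ hq _ => ⟨q, hq, by simp⟩
  | @cons x a y h p ih =>
    intro q hp hq hpq
    rw [Walk.cons_isPath_iff] at hp
    have ha : a ∉ q.support := by simpa using hpq
    have hq' : (Walk.cons h.symm q).IsPath := (Walk.cons_isPath_iff _ _).2 ⟨hq, ha⟩
    obtain ⟨r, hr, hlen⟩ := ih (Walk.cons h.symm q) hp.1 hq' (by
      by_contra! hcon
      obtain ⟨hpos, hmem⟩ := hcon
      have hnil : ¬ p.Nil := fun hn => hpos (Walk.length_eq_zero_iff.2 hn)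
      have := hG.eq_snd_of_adj_start hq' (p.adj_snd hnil) hmem
      simp only [Walk.snd_cons] at this
      exact hp.2 (this ▸ p.getVert_mem_support 1))
    exact ⟨r, hr, by simp at hlen ⊢; omega⟩

variable [G.LocallyFinite]

variable (G) in
/-- There is a leaf at distance `k` from `v` whose path from `v` avoids `u`. -/
def LeafBeyond (u v : V) (k : ℕ) : Prop :=
  ∃ (w : V) (p : G.Walk v w), G.IsLeafVertex w ∧ p.IsPath ∧ u ∉ p.support ∧ p.length = k

theorem LeafBeyond.succ (hG : G.IsAcyclic) {u v a : V} {k : ℕ} (huv : G.Adj u v) (hva : G.Adj v a)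
    (hau : a ≠ u) (h : G.LeafBeyond v a k) : G.LeafBeyond u v (k + 1) := by
  obtain ⟨w, p, hw, hp, hv, rfl⟩ := h
  have hp' : (Walk.cons hva p).IsPath := (Walk.cons_isPath_iff _ _).2 ⟨hp, hv⟩
  refine ⟨w, Walk.cons hva p, hw, hp', fun hmem => hau ?_, by simp⟩
  simpa using (hG.eq_snd_of_adj_start hp' huv.symm hmem).symm

theorem LeafBeyond.hasLeafLeafPath (hG : G.IsAcyclic) {v a b : V} {i j : ℕ} (hva : G.Adj v a)
    (hvb : G.Adj v b) (hab : a ≠ b) (hi : G.LeafBeyond v a i) (hj : G.LeafBeyond v b j) :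
    G.HasLeafLeafPath (i + j + 2) := by
  obtain ⟨x, p, hx, hp, hvp, rfl⟩ := hi
  obtain ⟨y, q, hy, hq, hvq, rfl⟩ := hj
  have hq' : (Walk.cons hvb q).IsPath := (Walk.cons_isPath_iff _ _).2 ⟨hq, hvq⟩
  obtain ⟨r, hr, hlen⟩ := hG.exists_isPath_join (Walk.cons hva p) (Walk.cons hvb q)
    ((Walk.cons_isPath_iff _ _).2 ⟨hp, hvp⟩) hq' (Or.inr fun hmem => hab (by
      simpa using hG.eq_snd_of_adj_start hq' hva (by simpa using hmem)))
  exact ⟨x, y, r, hx, hy, hr, by simp at hlen; omega⟩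

/-- The neighbours `a` and `b` of `v` have the same colour, and so do the two leaves; the parity of
a walk is determined by the colours of its ends. -/
theorem LeafBeyond.mod_two_eq (hG : G.LeavesInOneClass) {v a b : V} {i j : ℕ} (hva : G.Adj v a)
    (hvb : G.Adj v b) (hi : G.LeafBeyond v a i) (hj : G.LeafBeyond v b j) : i % 2 = j % 2 := by
  obtain ⟨c, hc⟩ := hG
  obtain ⟨x, p, hx, -, -, rfl⟩ := hi
  obtain ⟨y, q, hy, -, -, rfl⟩ := hj
  have h1 := c.even_length_iff_congr p
  have h2 := c.even_length_iff_congr q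
  have h3 := c.valid hva
  have h4 := c.valid hvb
  have h5 := hc x y hx hy
  have h6 : Even p.length ↔ Even q.length := by
    rw [h1, h2, h5]
    revert h3 h4
    cases c v <;> cases c a <;> cases c b <;> simp
  rw [Nat.even_iff, Nat.even_iff] at h6
  omega

theorem exists_adj_ne_ne {v : V} (hv : G.degree v = 3) (u a : V) :
    ∃ b, G.Adj v b ∧ b ≠ u ∧ b ≠ a := by
  classical
  have : 0 < ((G.neighborFinset v).erase u |>.erase a).card := by
    have h1 := Finset.pred_card_le_card_erase (s := G.neighborFinset v) (a := u)
    have h2 := Finset.pred_card_le_card_erase (s := (G.neighborFinset v).erase u) (a := a)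
    rw [G.card_neighborFinset_eq_degree, hv] at h1
    omega
  obtain ⟨b, hb⟩ := Finset.card_pos.1 this
  simp only [Finset.mem_erase, mem_neighborFinset] at hb
  exact ⟨b, hb.2.2, hb.2.1, hb.1⟩

end SimpleGraph

/-! ### Long leaf-leaf paths force all lengths up to 18 -/

namespace SimpleGraph

variable {V : Type*} {G : SimpleGraph V} [G.LocallyFinite]

/-- In a finite even 1-3 tree without leaf-leaf paths of length `2 * m`, every edge `u v` has a leaf
beyond it at distance less than `m` from `v`. -/
theorem IsEvenOneThreeTree.exists_leafBeyond_lt [Fintype V] (hG : G.IsEvenOneThreeTree) {m : ℕ}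
    (hm : 0 < m) (hno : ¬ G.HasLeafLeafPath (2 * m)) {u v : V} (huv : G.Adj u v) :
    ∃ j < m, G.LeafBeyond u v j := by
  have hac := hG.isTree.isAcyclic
  -- The path behind the edge `u v` makes the recursion terminate: it grows by one edge at each step
  -- and has fewer edges than the tree has vertices.
  suffices key : ∀ (n : ℕ) (r u v : V) (q : G.Walk r u) (h : G.Adj u v), (q.concat h).IsPath →
      Fintype.card V ≤ n + q.length → ∃ j < m, G.LeafBeyond u v j by
    refine key (Fintype.card V) u u v Walk.nil huv ?_ (by simp)
    simpa [Walk.concat] using huv.ne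
  intro n
  induction n with
  | zero =>
    intro r u v q h hp hcard
    have := hp.length_lt
    rw [Walk.length_concat] at this
    omega
  | succ n ih =>
    intro r u v q h hp hcard
    rcases hG.degree_eq v with hv | hv
    · exact ⟨0, hm, v, Walk.nil, hv, Walk.IsPath.nil, by simpa using h.ne, rfl⟩
    · have child : ∀ a, G.Adj v a → a ≠ u → ∃ j < m, G.LeafBeyond v a j := by
        intro a hva hau
        refine ih r v a (q.concat h) hva ?_ (by rw [Walk.length_concat]; omega)
        refine hp.concat (fun hmem => hau ?_) hva
        simpa using hac.eq_penultimate_of_adj_end hp hva hmem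
      obtain ⟨a, hva, hau, -⟩ := exists_adj_ne_ne hv u u
      obtain ⟨b, hvb, hbu, hba⟩ := exists_adj_ne_ne hv u a
      obtain ⟨i, hi, hia⟩ := child a hva hau
      obtain ⟨j, hj, hjb⟩ := child b hvb hbu
      have hij : i + j + 2 ≠ 2 * m := fun h =>
        hno (h ▸ hia.hasLeafLeafPath hac hva hvb hba.symm hjb)
      -- If `i = m - 1`, then `hij` excludes `j = m - 1`, so the other branch serves.
      rcases lt_or_ge (i + 1) m with h1 | h1
      · exact ⟨i + 1, h1, hia.succ hac h hva hau⟩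
      · exact ⟨j + 1, by omega, hjb.succ hac h hvb hbu⟩

/-- Along a path that ends in a leaf, the leaf depths listed by `forcedDepths` occur. -/
theorem IsEvenOneThreeTree.exists_mem_forcedDepths [Fintype V] (hG : G.IsEvenOneThreeTree) {m : ℕ}
    (hm : 0 < m) (hno : ¬ G.HasLeafLeafPath (2 * m)) {v w : V} (p : G.Walk v w) :
    ∀ u : V, G.Adj u v → p.IsPath → u ∉ p.support → G.IsLeafVertex w →
      ∃ s ∈ forcedDepths m p.length, ∀ k, s.testBit k → G.LeafBeyond u v k := by
  have hac := hG.isTree.isAcyclic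
  induction p with
  | @nil v =>
    intro u huv _ hu hw
    refine ⟨1, by simp [forcedDepths], fun k hk => ?_⟩
    obtain rfl : k = 0 := Nat.testBit_one_eq_true_iff_self_eq_zero.1 hk
    exact ⟨v, Walk.nil, hw, Walk.IsPath.nil, hu, rfl⟩
  | @cons v a w hva p ih =>
    intro u huv hp hu hw
    rw [Walk.cons_isPath_iff] at hp
    have hau : a ≠ u := by
      rintro rfl
      simp at hu
    have hv : G.degree v = 3 := (hG.degree_eq v).resolve_left fun h1 => by
      rw [← G.card_neighborFinset_eq_degree, Finset.card_eq_one] at h1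
      obtain ⟨x, hx⟩ := h1
      have h2 : a ∈ G.neighborFinset v := by simpa using hva
      have h3 : u ∈ G.neighborFinset v := by simpa using huv.symm
      rw [hx, Finset.mem_singleton] at h2 h3
      exact hau (h2.trans h3.symm)
    obtain ⟨b, hvb, hbu, hba⟩ := exists_adj_ne_ne hv u a
    obtain ⟨s, hs, hsa⟩ := ih v hva hp.1 hp.2 hw
    obtain ⟨j, hj, hjb⟩ := hG.exists_leafBeyond_lt hm hno hvb
    have hpar : j % 2 = p.length % 2 :=
      hjb.mod_two_eq hG.even hvb hva ⟨w, p, hw, hp.1, hp.2, rfl⟩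
    have hsj : s.testBit (2 * m - 2 - j) = false := by
      by_contra hcon
      have := (hsa _ (by simpa using hcon)).hasLeafLeafPath hac hva hvb hba.symm hjb
      exact hno (by convert this using 1; omega)
    obtain ⟨t, ht, hts⟩ := exists_mem_forcedDepths_succ hs hj hpar hsj
    refine ⟨t, ht, fun k hk => ?_⟩
    obtain ⟨i, rfl, hi | rfl⟩ := hts k hk
    · exact (hsa i hi).succ hac huv hva hau
    · exact hjb.succ hac huv hvb hbu

/-- A ball is covered by the closed neighbourhoods, of at most 4 vertices each, of the vertices in
the ball of radius one less. -/
theorem Connected.card_dist_le [Fintype V] (hG : G.Connected) (hdeg : ∀ v, G.degree v ≤ 3) (r : V)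
    (n : ℕ) : (Finset.univ.filter fun v => G.dist r v ≤ n).card ≤ 4 ^ n := by
  classical
  induction n with
  | zero =>
    rw [pow_zero, Finset.card_le_one]
    intro a ha b hb
    simp only [nonpos_iff_eq_zero, Finset.mem_filter, Finset.mem_univ, true_and,
      hG.dist_eq_zero_iff] at ha hb
    rw [← ha, ← hb]
  | succ n ih =>
    have hsub : (Finset.univ.filter fun v => G.dist r v ≤ n + 1) ⊆
        (Finset.univ.filter fun v => G.dist r v ≤ n).biUnion
          fun v => insert v (G.neighborFinset v) := by
      intro v hv
      simp only [Finset.mem_filter, Finset.mem_univ, true_and, Finset.mem_biUnion,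
        Finset.mem_insert, mem_neighborFinset] at hv ⊢
      obtain ⟨p, hp⟩ := hG.exists_walk_length_eq_dist v r
      cases p with
      | nil => exact ⟨r, by simp, Or.inl rfl⟩
      | @cons _ a _ h p =>
        refine ⟨a, ?_, Or.inr h.symm⟩
        rw [dist_comm, ← hp, Walk.length_cons] at hv
        rw [dist_comm]
        exact (dist_le p).trans (by omega)
    calc _ ≤ _ := Finset.card_le_card hsub
      _ ≤ (Finset.univ.filter fun v => G.dist r v ≤ n).card * 4 :=
        Finset.card_biUnion_le_card_mul _ _ _ fun v _ =>
          (Finset.card_insert_le _ _).trans (by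
            rw [G.card_neighborFinset_eq_degree]
            have := hdeg v
            omega)
      _ ≤ _ := by
        rw [pow_succ]
        exact Nat.mul_le_mul_right _ ih

/-- Even 1-3 trees with more than `4 ^ 60` vertices have leaf-leaf paths of each of the
lengths `0, 2, …, 18`. -/
theorem IsEvenOneThreeTree.hasLeafLeafPath [Fintype V] (hG : G.IsEvenOneThreeTree)
    (hcard : 4 ^ 60 < Fintype.card V) {m : ℕ} (hm : m ≤ 9) : G.HasLeafLeafPath (2 * m) := by
  have hac := hG.isTree.isAcyclic
  have hconn := hG.isTree.connected
  have : Nontrivial V := Fintype.one_lt_card_iff_nontrivial.1 (lt_trans (by norm_num) hcard)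
  have : Finite G.edgeSet := Subtype.finite
  obtain ⟨r, -, -, hr, -⟩ := hG.isTree.exists_ne_and_degree_eq_one
  rcases Nat.eq_zero_or_pos m with rfl | hm0
  · exact ⟨r, r, Walk.nil, hr, hr, Walk.IsPath.nil, rfl⟩
  by_contra hno
  obtain ⟨x, hx⟩ : ∃ x, 60 < G.dist r x := by
    by_contra! hall
    have := hconn.card_dist_le (fun v => by rcases hG.degree_eq v with h | h <;> omega) r 60
    rw [Finset.filter_true_of_mem fun v _ => hall v, Finset.card_univ] at this
    omega
  obtain ⟨p, hp, hpl⟩ := hconn.exists_path_of_dist r x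
  -- If `x` is not a leaf, the path from `r` is prolonged past `x` to some leaf beyond a neighbour
  -- that is not on it.
  obtain ⟨w, q, hw, hq, hql⟩ : ∃ (w : V) (q : G.Walk r w),
      G.IsLeafVertex w ∧ q.IsPath ∧ 60 < q.length := by
    rcases hG.degree_eq x with h1 | h3
    · exact ⟨x, p, h1, hp, hpl ▸ hx⟩
    · obtain ⟨a, hxa, hau, -⟩ := exists_adj_ne_ne h3 p.reverse.snd p.reverse.snd
      obtain ⟨j, -, w, q, hw, hq, hxq, -⟩ := hG.exists_leafBeyond_lt hm0 hno hxa
      have hq' : (Walk.cons hxa q).IsPath := (Walk.cons_isPath_iff _ _).2 ⟨hq, hxq⟩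
      have hnil : ¬ p.reverse.Nil := fun hn => by
        have := Walk.length_eq_zero_iff.2 hn
        rw [Walk.length_reverse] at this
        omega
      obtain ⟨s, hs, hsl⟩ := hac.exists_isPath_join p.reverse (Walk.cons hxa q) hp.reverse hq'
        (Or.inr fun hmem => hau (by
          simpa using (hac.eq_snd_of_adj_start hq' (p.reverse.adj_snd hnil) hmem).symm))
      exact ⟨w, s, hw, hs, by rw [hsl, Walk.length_reverse]; omega⟩
  cases q with
  | nil => simp at hql
  | cons h q =>
    rw [Walk.cons_isPath_iff] at hq
    -- Without its first edge the path avoids `r` and still has at least 60 edges.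
    obtain ⟨s, hs, -⟩ := hG.exists_mem_forcedDepths hm0 hno q _ h hq.1 hq.2 hw
    rw [forcedDepths_eq_nil hm (by rw [Walk.length_cons] at hql; omega)] at hs
    simp at hs

end SimpleGraph

/-! ### Tools: acyclicity, distances, transport along isomorphisms -/

namespace SimpleGraph

/-- A graph is acyclic if every vertex has at most one neighbour that is not above it with respect
to some level function. -/
theorem isAcyclic_of_level {V : Type*} {G : SimpleGraph V} (f : V → ℕ)
    (h : ∀ x y z, G.Adj x y → G.Adj x z → f y ≤ f x → f z ≤ f x → y = z) : G.IsAcyclic := by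
  classical
  intro v c hc
  -- At a vertex of highest level on a cycle, the two distinct cycle neighbours are both not above
  -- it.
  obtain ⟨x, hx, hmax⟩ := c.support.toFinset.exists_max_image f ⟨v, by simp⟩
  rw [List.mem_toFinset] at hx
  have hd := hc.rotate hx
  have hle : ∀ y ∈ (c.rotate x hx).support, f y ≤ f x := fun y hy =>
    hmax y (by simpa [Walk.mem_support_rotate_iff] using hy)
  exact hd.snd_ne_penultimate (h x _ _ ((c.rotate x hx).adj_snd hd.not_nil)
    ((c.rotate x hx).adj_penultimate hd.not_nil).symm
    (hle _ (Walk.getVert_mem_support _ _)) (hle _ (Walk.getVert_mem_support _ _)))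

theorem Walk.abs_sub_le_length {V : Type*} {G : SimpleGraph V} (f : V → ℤ)
    (hf : ∀ x y, G.Adj x y → |f x - f y| ≤ 1) {u v : V} (p : G.Walk u v) :
    |f u - f v| ≤ p.length := by
  induction p with
  | nil => simp
  | cons h p ih =>
    rw [Walk.length_cons]
    push_cast
    exact (abs_sub_le _ _ _).trans (by linarith [hf _ _ h])

theorem IsTree.length_eq_dist {V : Type*} {G : SimpleGraph V} (hG : G.IsTree) {u v : V}
    {p : G.Walk u v} (hp : p.IsPath) : p.length = G.dist u v := by
  obtain ⟨q, hq, hlen⟩ := hG.connected.exists_path_of_dist u v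
  rw [← hlen, (hG.existsUnique_path u v).unique hp hq]

section Iso

variable {V W : Type*} {G : SimpleGraph V} {H : SimpleGraph W} [G.LocallyFinite] [H.LocallyFinite]

theorem Iso.isLeafVertex_iff (e : G ≃g H) (v : V) : H.IsLeafVertex (e v) ↔ G.IsLeafVertex v := by
  rw [IsLeafVertex, IsLeafVertex, e.degree_eq]

theorem Iso.isEvenOneThreeTree (e : G ≃g H) (h : G.IsEvenOneThreeTree) :
    H.IsEvenOneThreeTree where
  isTree := e.isTree_iff.1 h.isTree
  degree_eq v := by
    have := h.degree_eq (e.symm v)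
    rwa [e.symm.degree_eq] at this
  even := by
    obtain ⟨c, hc⟩ := h.even
    exact ⟨c.comp e.symm.toHom, fun u v hu hv =>
      hc _ _ ((e.symm.isLeafVertex_iff u).2 hu) ((e.symm.isLeafVertex_iff v).2 hv)⟩

theorem Iso.hasLeafLeafPath (e : G ≃g H) {l : ℕ} (h : G.HasLeafLeafPath l) :
    H.HasLeafLeafPath l := by
  obtain ⟨u, v, p, hu, hv, hp, rfl⟩ := h
  exact ⟨_, _, p.map e.toHom, (e.isLeafVertex_iff u).2 hu, (e.isLeafVertex_iff v).2 hv,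
    hp.map e.injective, Walk.length_map _ _⟩

end Iso

end SimpleGraph

/-! ### Caterpillars of perfect binary trees -/

/-- In heap order the parent of `i` is `i / 2`, so the binary length `Nat.size` measures the
distance to the spine. -/
theorem Nat.size_div_two {i : ℕ} (hi : i ≠ 0) : (i / 2).size + 1 = i.size := by
  apply le_antisymm
  · rw [Nat.succ_le_iff, Nat.lt_size]
    have h : 2 ^ ((i / 2).size) ≤ 2 * (i / 2) ∨ i / 2 = 0 := by
      rcases Nat.eq_zero_or_pos (i / 2) with h0 | h0
      · exact Or.inr h0
      · obtain ⟨n, hn⟩ := Nat.exists_eq_succ_of_ne_zero (Nat.size_pos.2 h0).ne'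
        have : 2 ^ n ≤ i / 2 := Nat.lt_size.1 (by omega)
        rw [hn, Nat.succ_eq_add_one, pow_succ]
        omega
    rcases h with h | h
    · omega
    · rw [h, Nat.size_zero]
      omega
  · rw [Nat.size_le, pow_succ]
    have := Nat.lt_size_self (i / 2)
    omega

/-- The vertices `(t, i)` with `t < N` and `i < 2 ^ k t`. -/
def caterpillarVertices (N : ℕ) (k : ℕ → ℕ) : Finset (Σ _ : ℕ, ℕ) :=
  (Finset.range N).sigma fun t => Finset.range (2 ^ k t)

theorem mem_caterpillarVertices {N : ℕ} {k : ℕ → ℕ} {x : Σ _ : ℕ, ℕ} :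
    x ∈ caterpillarVertices N k ↔ x.1 < N ∧ x.2 < 2 ^ k x.1 := by
  simp [caterpillarVertices]

/-- The relation "`y` is the parent of `x`": the vertices `(t, i)` with `0 < i` form a binary tree
in heap order, whose root `(t, 1)` hangs below the spine vertex `(t, 0)`. -/
def IsCaterpillarParent (x y : Σ _ : ℕ, ℕ) : Prop :=
  (x.2 ≠ 0 ∧ y.1 = x.1 ∧ y.2 = x.2 / 2) ∨ (x.2 = 0 ∧ y.2 = 0 ∧ x.1 = y.1 + 1)

instance : DecidableRel IsCaterpillarParent := fun _ _ => instDecidableOr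

/-- The caterpillar of perfect binary trees: a perfect binary tree with leaves at distance `k t` from
the spine is attached to the spine vertex `(t, 0)`. -/
def caterpillar (N : ℕ) (k : ℕ → ℕ) : SimpleGraph (caterpillarVertices N k) where
  Adj x y := IsCaterpillarParent x.1 y.1 ∨ IsCaterpillarParent y.1 x.1
  symm := ⟨fun _ _ h => h.symm⟩
  loopless := ⟨fun x h => by
    rcases x with ⟨⟨t, i⟩, hx⟩
    simp only [IsCaterpillarParent] at h
    omega⟩

instance (N : ℕ) (k : ℕ → ℕ) : DecidableRel (caterpillar N k).Adj := fun _ _ => instDecidableOr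

/-- Distance to the vertex `(0, 0)`. -/
def caterpillarLevel (x : Σ _ : ℕ, ℕ) : ℕ := x.1 + x.2.size

theorem IsCaterpillarParent.level {x y : Σ _ : ℕ, ℕ} (h : IsCaterpillarParent x y) :
    caterpillarLevel y + 1 = caterpillarLevel x := by
  rcases x with ⟨t, i⟩
  rcases y with ⟨s, j⟩
  simp only [IsCaterpillarParent] at h
  rcases h with ⟨h0, rfl, rfl⟩ | ⟨rfl, rfl, rfl⟩
  · have := Nat.size_div_two h0
    simp only [caterpillarLevel] at this ⊢
    omega
  · simp [caterpillarLevel]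

theorem IsCaterpillarParent.unique {x y z : Σ _ : ℕ, ℕ} (hy : IsCaterpillarParent x y)
    (hz : IsCaterpillarParent x z) : y = z := by
  rcases x with ⟨t, i⟩
  rcases y with ⟨s, j⟩
  rcases z with ⟨r, l⟩
  simp only [IsCaterpillarParent] at hy hz
  obtain ⟨rfl, rfl⟩ : s = r ∧ j = l := by omega
  rfl

section Caterpillar

open SimpleGraph

variable {N : ℕ} {k : ℕ → ℕ}

theorem caterpillar_isAcyclic : (caterpillar N k).IsAcyclic := by
  refine isAcyclic_of_level (fun x => caterpillarLevel x.1) fun x y z hy hz hyx hzx => ?_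
  rcases hy with hy | hy
  · rcases hz with hz | hz
    · exact Subtype.ext (hy.unique hz)
    · have := hz.level
      omega
  · have := hy.level
    omega

theorem caterpillar_exists_parent (x : caterpillarVertices N k) (hx : caterpillarLevel x.1 ≠ 0) :
    ∃ y : caterpillarVertices N k, IsCaterpillarParent x.1 y.1 := by
  rcases x with ⟨⟨t, i⟩, hx'⟩
  have hm := mem_caterpillarVertices.1 hx'
  simp only at hm
  by_cases hi : i = 0
  · subst hi
    have ht : t ≠ 0 := by
      rintro rfl
      simp [caterpillarLevel] at hx
    exact ⟨⟨⟨t - 1, 0⟩, mem_caterpillarVertices.2 ⟨by simp only; omega, by positivity⟩⟩,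
      Or.inr ⟨rfl, rfl, by simp only; omega⟩⟩
  · exact ⟨⟨⟨t, i / 2⟩, mem_caterpillarVertices.2 ⟨hm.1, by simp only; omega⟩⟩,
      Or.inl ⟨hi, rfl, rfl⟩⟩

theorem caterpillar_connected (hN : 0 < N) : (caterpillar N k).Connected := by
  have hroot : (⟨0, 0⟩ : Σ _ : ℕ, ℕ) ∈ caterpillarVertices N k :=
    mem_caterpillarVertices.2 ⟨hN, by positivity⟩
  have key : ∀ (n : ℕ) (x : caterpillarVertices N k), caterpillarLevel x.1 = n →
      (caterpillar N k).Reachable x ⟨_, hroot⟩ := by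
    intro n
    induction n with
    | zero =>
      intro x hx
      obtain ⟨⟨t, i⟩, hm⟩ := x
      simp only [caterpillarLevel, Nat.add_eq_zero_iff, Nat.size_eq_zero] at hx
      obtain ⟨rfl, rfl⟩ := hx
      exact Reachable.refl _
    | succ n ih =>
      intro x hx
      obtain ⟨y, hy⟩ := caterpillar_exists_parent x (by omega)
      have hadj : (caterpillar N k).Adj x y := Or.inl hy
      exact hadj.reachable.trans (ih y (by have := hy.level; omega))
  have : Nonempty (caterpillarVertices N k) := ⟨⟨_, hroot⟩⟩
  exact ⟨fun x y => (key _ x rfl).trans (key _ y rfl).symm⟩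

theorem caterpillar_degree (x : caterpillarVertices N k) : (caterpillar N k).degree x =
    ((caterpillarVertices N k).filter fun y =>
      IsCaterpillarParent x.1 y ∨ IsCaterpillarParent y x.1).card := by
  rw [← card_neighborFinset_eq_degree, ← Finset.card_map (Function.Embedding.subtype _)]
  congr 1
  ext y
  simp only [Finset.mem_map, mem_neighborFinset, Function.Embedding.subtype_apply, Subtype.exists,
    exists_and_right, exists_eq_right, Finset.mem_filter]
  exact ⟨fun ⟨hy, h⟩ => ⟨hy, h⟩, fun ⟨hy, h⟩ => ⟨hy, h⟩⟩

theorem caterpillar_degree_of_size_eq {t i : ℕ} (hx : ⟨t, i⟩ ∈ caterpillarVertices N k)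
    (hi : i ≠ 0) (hs : i.size = k t) : (caterpillar N k).degree ⟨_, hx⟩ = 1 := by
  rw [caterpillar_degree, Finset.card_eq_one]
  have hm := mem_caterpillarVertices.1 hx
  refine ⟨⟨t, i / 2⟩, ?_⟩
  ext ⟨s, j⟩
  -- The would-be children `2 * i` and `2 * i + 1` are out of range.
  have hpow : 2 ^ k t ≤ 2 * i := by
    obtain ⟨n, hn⟩ : ∃ n, k t = n + 1 := ⟨(i / 2).size, by rw [← hs, Nat.size_div_two hi]⟩
    have : 2 ^ n ≤ i := Nat.lt_size.1 (by omega)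
    rw [hn, pow_succ]
    omega
  rw [Finset.mem_filter, mem_caterpillarVertices]
  simp only [IsCaterpillarParent, Finset.mem_singleton,
    Sigma.mk.injEq, heq_eq_eq] at hm ⊢
  constructor
  · rintro ⟨⟨h1, h2⟩, h3⟩
    by_cases hst : s = t
    · subst hst
      omega
    · omega
  · rintro ⟨rfl, rfl⟩
    omega

theorem caterpillar_degree_of_size_lt {t i : ℕ} (hx : ⟨t, i⟩ ∈ caterpillarVertices N k)
    (hi : i ≠ 0) (hs : i.size < k t) : (caterpillar N k).degree ⟨_, hx⟩ = 3 := by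
  rw [caterpillar_degree, Finset.card_eq_three]
  have hm := mem_caterpillarVertices.1 hx
  refine ⟨⟨t, i / 2⟩, ⟨t, 2 * i⟩, ⟨t, 2 * i + 1⟩, by simp; omega, by simp; omega, by simp, ?_⟩
  ext ⟨s, j⟩
  have hpow : 2 * i + 1 < 2 ^ k t := by
    obtain ⟨n, hn⟩ : ∃ n, k t = n + 1 := ⟨k t - 1, by omega⟩
    have : i < 2 ^ n := Nat.size_le.1 (by omega)
    rw [hn, pow_succ]
    omega
  rw [Finset.mem_filter, mem_caterpillarVertices]
  simp only [IsCaterpillarParent, Finset.mem_singleton,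
    Finset.mem_insert, Sigma.mk.injEq, heq_eq_eq] at hm ⊢
  constructor
  · omega
  · rintro (⟨rfl, rfl⟩ | ⟨rfl, rfl⟩ | ⟨rfl, rfl⟩) <;> omega

theorem caterpillar_degree_spine {t : ℕ} (hx : ⟨t, 0⟩ ∈ caterpillarVertices N k)
    (ht : t ≠ 0) (htN : t + 1 < N) (hk : k t ≠ 0) : (caterpillar N k).degree ⟨_, hx⟩ = 3 := by
  rw [caterpillar_degree, Finset.card_eq_three]
  refine ⟨⟨t - 1, 0⟩, ⟨t + 1, 0⟩, ⟨t, 1⟩, by simp, by simp, by simp, ?_⟩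
  ext ⟨s, j⟩
  have h0 : ∀ s, 0 < 2 ^ k s := fun s => by positivity
  have h1 : 1 < 2 ^ k t := Nat.one_lt_two_pow hk
  rw [Finset.mem_filter, mem_caterpillarVertices]
  simp only [IsCaterpillarParent, Finset.mem_singleton,
    Finset.mem_insert, Sigma.mk.injEq, heq_eq_eq, ne_eq, not_true_eq_false, false_and,
    true_and, false_or]
  constructor
  · omega
  · rintro (⟨rfl, rfl⟩ | ⟨rfl, rfl⟩ | ⟨rfl, rfl⟩)
    · have := h0 (t - 1)
      omega
    · have := h0 (t + 1)
      omega
    · omega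

theorem caterpillar_degree_first (hx : ⟨0, 0⟩ ∈ caterpillarVertices N k) (hN : 1 < N)
    (hk : k 0 = 0) : (caterpillar N k).degree ⟨_, hx⟩ = 1 := by
  rw [caterpillar_degree, Finset.card_eq_one]
  refine ⟨⟨1, 0⟩, ?_⟩
  ext ⟨s, j⟩
  have h0 : 0 < 2 ^ k 1 := by positivity
  rw [Finset.mem_filter, mem_caterpillarVertices]
  simp only [IsCaterpillarParent, Finset.mem_singleton,
    Sigma.mk.injEq, heq_eq_eq, ne_eq, not_true_eq_false, false_and,
    true_and, false_or]
  constructor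
  · rintro ⟨⟨h1, h2⟩, h3⟩
    by_cases hs : s = 0
    · subst hs
      rw [hk] at h2
      omega
    · omega
  · rintro ⟨rfl, rfl⟩
    omega

theorem caterpillar_degree_last {t : ℕ} (hx : ⟨t, 0⟩ ∈ caterpillarVertices N k) (ht : t ≠ 0)
    (hN : t + 1 = N) (hk : k t = 0) : (caterpillar N k).degree ⟨_, hx⟩ = 1 := by
  rw [caterpillar_degree, Finset.card_eq_one]
  refine ⟨⟨t - 1, 0⟩, ?_⟩
  ext ⟨s, j⟩
  have h0 : 0 < 2 ^ k (t - 1) := by positivity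
  rw [Finset.mem_filter, mem_caterpillarVertices]
  simp only [IsCaterpillarParent, Finset.mem_singleton,
    Sigma.mk.injEq, heq_eq_eq, ne_eq, not_true_eq_false, false_and,
    true_and, false_or]
  constructor
  · rintro ⟨⟨h1, h2⟩, h3⟩
    by_cases hs : s = t
    · subst hs
      rw [hk] at h2
      omega
    · omega
  · rintro ⟨rfl, rfl⟩
    omega

end Caterpillar

section Caterpillar

open SimpleGraph

variable {N : ℕ} {k : ℕ → ℕ}

/-- Every vertex of a caterpillar whose two end trees are trivial, and whose other trees are not, has
degree `1` or `3`; the vertices of degree `1` are the vertices `(t, i)` at distance `k t` from the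
spine. -/
theorem caterpillar_degree_eq (hN : 1 < N) (hk0 : k 0 = 0) (hkN : k (N - 1) = 0)
    (hk : ∀ t, t ≠ 0 → t + 1 < N → k t ≠ 0) (x : caterpillarVertices N k) :
    ((caterpillar N k).degree x = 1 ∧ x.1.2.size = k x.1.1) ∨ (caterpillar N k).degree x = 3 := by
  obtain ⟨⟨t, i⟩, hx⟩ := x
  have hm := mem_caterpillarVertices.1 hx
  by_cases hi : i = 0
  · subst hi
    by_cases ht : t = 0
    · subst ht
      exact Or.inl ⟨caterpillar_degree_first hx hN hk0, by simp [hk0]⟩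
    · by_cases htN : t + 1 = N
      · obtain rfl : t = N - 1 := by omega
        exact Or.inl ⟨caterpillar_degree_last hx ht htN hkN, by simp [hkN]⟩
      · have htN' : t + 1 < N := by
          simp only at hm
          omega
        exact Or.inr (caterpillar_degree_spine hx ht htN' (hk t ht htN'))
  · rcases (Nat.size_le.2 hm.2).lt_or_eq with h | h
    · exact Or.inr (caterpillar_degree_of_size_lt hx hi h)
    · exact Or.inl ⟨caterpillar_degree_of_size_eq hx hi h, h⟩

theorem caterpillar_isEvenOneThreeTree (hN : 1 < N) (hk0 : k 0 = 0) (hkN : k (N - 1) = 0)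
    (hk : ∀ t, t ≠ 0 → t + 1 < N → k t ≠ 0) (hpar : ∀ t < N, Even (t + k t)) :
    (caterpillar N k).IsEvenOneThreeTree where
  isTree := ⟨caterpillar_connected (by omega), caterpillar_isAcyclic⟩
  degree_eq x := (caterpillar_degree_eq hN hk0 hkN hk x).imp_left And.left
  even := by
    -- Parent and child differ by one in level, and a leaf over position `t` has level `t + k t`.
    refine ⟨Coloring.mk (fun x => decide (Even (caterpillarLevel x.1))) fun {x y} h heq => ?_, ?_⟩
    · rw [decide_eq_decide, Nat.even_iff, Nat.even_iff] at heq
      rcases h with h | h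
      · have := h.level
        omega
      · have := h.level
        omega
    · have key : ∀ x : caterpillarVertices N k, (caterpillar N k).IsLeafVertex x →
          decide (Even (caterpillarLevel x.1)) = true := by
        intro x hx
        rcases caterpillar_degree_eq hN hk0 hkN hk x with h | h
        · rw [decide_eq_true_eq, caterpillarLevel, h.2]
          exact hpar _ (mem_caterpillarVertices.1 x.2).1
        · rw [IsLeafVertex, h] at hx
          omega
      exact fun x y hx hy => (key x hx).trans (key y hy).symm

theorem caterpillar_dist_spine_le (hN : 0 < N) {t : ℕ} :
    ∀ (i : ℕ) (hi : ⟨t, i⟩ ∈ caterpillarVertices N k) (h0 : ⟨t, 0⟩ ∈ caterpillarVertices N k),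
      (caterpillar N k).dist ⟨_, hi⟩ ⟨_, h0⟩ ≤ i.size := by
  intro i
  induction i using Nat.strong_induction_on with
  | _ i ih =>
    intro hi h0
    by_cases hi0 : i = 0
    · subst hi0
      simp
    · have hm := mem_caterpillarVertices.1 hi
      have hh : (⟨t, i / 2⟩ : Σ _ : ℕ, ℕ) ∈ caterpillarVertices N k :=
        mem_caterpillarVertices.2 ⟨hm.1, lt_of_le_of_lt (Nat.div_le_self _ _) hm.2⟩
      have hadj : (caterpillar N k).Adj ⟨_, hi⟩ ⟨_, hh⟩ := Or.inl (Or.inl ⟨hi0, rfl, rfl⟩)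
      have h1 := ih (i / 2) (by omega) hh h0
      have h2 := (caterpillar_connected (k := k) hN).dist_triangle (u := ⟨_, hi⟩) (v := ⟨_, hh⟩)
        (w := ⟨_, h0⟩)
      have h3 := dist_eq_one_iff_adj.2 hadj
      have h4 := Nat.size_div_two hi0
      omega

theorem caterpillar_dist_root_lt (hN : 0 < N) {t : ℕ} :
    ∀ (i : ℕ) (hi : ⟨t, i⟩ ∈ caterpillarVertices N k) (h1 : ⟨t, 1⟩ ∈ caterpillarVertices N k),
      i ≠ 0 → (caterpillar N k).dist ⟨_, hi⟩ ⟨_, h1⟩ < i.size := by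
  intro i
  induction i using Nat.strong_induction_on with
  | _ i ih =>
    intro hi h1 hi0
    by_cases hi1 : i = 1
    · subst hi1
      simp
    · have hm := mem_caterpillarVertices.1 hi
      have hh : (⟨t, i / 2⟩ : Σ _ : ℕ, ℕ) ∈ caterpillarVertices N k :=
        mem_caterpillarVertices.2 ⟨hm.1, lt_of_le_of_lt (Nat.div_le_self _ _) hm.2⟩
      have hadj : (caterpillar N k).Adj ⟨_, hi⟩ ⟨_, hh⟩ := Or.inl (Or.inl ⟨hi0, rfl, rfl⟩)
      have h5 := ih (i / 2) (by omega) hh h1 (by omega)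
      have h2 := (caterpillar_connected (k := k) hN).dist_triangle (u := ⟨_, hi⟩) (v := ⟨_, hh⟩)
        (w := ⟨_, h1⟩)
      have h3 := dist_eq_one_iff_adj.2 hadj
      have h4 := Nat.size_div_two hi0
      omega

theorem caterpillar_dist_spine_spine_le (hN : 0 < N) {t : ℕ}
    (ht : ⟨t, 0⟩ ∈ caterpillarVertices N k) :
    ∀ (d : ℕ) (hd : ⟨t + d, 0⟩ ∈ caterpillarVertices N k),
      (caterpillar N k).dist ⟨_, ht⟩ ⟨_, hd⟩ ≤ d := by
  intro d
  induction d with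
  | zero => intro hd; simp
  | succ d ih =>
    intro hd
    have hm := mem_caterpillarVertices.1 hd
    have hh : (⟨t + d, 0⟩ : Σ _ : ℕ, ℕ) ∈ caterpillarVertices N k :=
      mem_caterpillarVertices.2 ⟨by simp only at hm ⊢; omega, by positivity⟩
    have hadj : (caterpillar N k).Adj ⟨_, hh⟩ ⟨_, hd⟩ := Or.inr (Or.inr ⟨rfl, rfl, rfl⟩)
    have h1 := ih hh
    have h2 := (caterpillar_connected (k := k) hN).dist_triangle (u := ⟨_, ht⟩) (v := ⟨_, hh⟩)
        (w := ⟨_, hd⟩)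
    have h3 := dist_eq_one_iff_adj.2 hadj
    omega

theorem caterpillar_dist_of_lt (hN : 0 < N) (x y : caterpillarVertices N k)
    (hxy : x.1.1 < y.1.1) :
    (caterpillar N k).dist x y = x.1.2.size + y.1.2.size + (y.1.1 - x.1.1) := by
  have hconn := caterpillar_connected (k := k) hN
  obtain ⟨⟨t, i⟩, hx⟩ := x
  obtain ⟨⟨s, j⟩, hy⟩ := y
  have hmx := mem_caterpillarVertices.1 hx
  have hmy := mem_caterpillarVertices.1 hy
  simp only at hxy hmx hmy ⊢
  apply le_antisymm
  · obtain ⟨d, rfl⟩ := Nat.exists_eq_add_of_le hxy.le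
    have hx0 : (⟨t, 0⟩ : Σ _ : ℕ, ℕ) ∈ caterpillarVertices N k :=
      mem_caterpillarVertices.2 ⟨hmx.1, by positivity⟩
    have hy0 : (⟨t + d, 0⟩ : Σ _ : ℕ, ℕ) ∈ caterpillarVertices N k :=
      mem_caterpillarVertices.2 ⟨hmy.1, by positivity⟩
    have h1 := caterpillar_dist_spine_le hN i hx hx0
    have h2 := caterpillar_dist_spine_le hN j hy hy0
    have h3 := caterpillar_dist_spine_spine_le hN hx0 d hy0
    have h4 := hconn.dist_triangle (u := ⟨_, hx⟩) (v := ⟨_, hx0⟩) (w := ⟨_, hy⟩)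
    have h5 := hconn.dist_triangle (u := ⟨_, hx0⟩) (v := ⟨_, hy0⟩) (w := ⟨_, hy⟩)
    rw [SimpleGraph.dist_comm] at h2
    omega
  · obtain ⟨p, hp⟩ := hconn.exists_walk_length_eq_dist ⟨_, hx⟩ ⟨_, hy⟩
    rw [← hp]
    -- For the lower bound, unfold the tree onto a line: trees at positions up to `t` point left,
    -- the later ones right. This map is 1-Lipschitz and separates the two vertices by the claimed
    -- distance.
    have h1 := p.abs_sub_le_length
      (fun z => if z.1.1 ≤ t then (z.1.1 : ℤ) - z.1.2.size else z.1.1 + z.1.2.size) (by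
        suffices key : ∀ a b : Σ _ : ℕ, ℕ, IsCaterpillarParent a b →
            |(if a.1 ≤ t then (a.1 : ℤ) - a.2.size else a.1 + a.2.size) -
              (if b.1 ≤ t then (b.1 : ℤ) - b.2.size else b.1 + b.2.size)| ≤ 1 by
          rintro a b (h | h)
          · exact key _ _ h
          · rw [abs_sub_comm]
            exact key _ _ h
        rintro ⟨a, i⟩ ⟨b, j⟩ h
        simp only [IsCaterpillarParent] at h ⊢
        rw [abs_le]
        rcases h with ⟨h0, rfl, rfl⟩ | ⟨rfl, rfl, rfl⟩
        · have := Nat.size_div_two h0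
          split_ifs <;> omega
        · simp only [Nat.size_zero]
          split_ifs <;> omega)
    simp only [le_refl, if_true, if_neg (not_le.2 hxy)] at h1
    rw [abs_le] at h1
    omega

/-- Both vertices reach the root `(t, 1)` in fewer steps than their common size. On the spine they
coincide, and the truncated subtraction gives 0. -/
theorem caterpillar_dist_le_of_eq (hN : 0 < N) (x y : caterpillarVertices N k)
    (hxy : x.1.1 = y.1.1) (hsize : x.1.2.size = y.1.2.size) :
    (caterpillar N k).dist x y ≤ 2 * x.1.2.size - 2 := by
  have hconn := caterpillar_connected (k := k) hN
  obtain ⟨⟨t, i⟩, hx⟩ := x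
  obtain ⟨⟨s, j⟩, hy⟩ := y
  have hmx := mem_caterpillarVertices.1 hx
  simp only at hxy hsize hmx ⊢
  subst hxy
  by_cases hi : i = 0
  · subst hi
    obtain rfl : j = 0 := Nat.size_eq_zero.1 (by simpa using hsize.symm)
    simp
  · have hj : j ≠ 0 := by
      rintro rfl
      exact hi (Nat.size_eq_zero.1 (by simpa using hsize))
    have h1 : (⟨t, 1⟩ : Σ _ : ℕ, ℕ) ∈ caterpillarVertices N k :=
      mem_caterpillarVertices.2 ⟨hmx.1, by simp only; omega⟩
    have h2 := caterpillar_dist_root_lt hN i hx h1 hi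
    have h3 := caterpillar_dist_root_lt hN j hy h1 hj
    have h4 := hconn.dist_triangle (u := ⟨_, hx⟩) (v := ⟨_, h1⟩) (w := ⟨_, hy⟩)
    rw [SimpleGraph.dist_comm] at h3
    omega

theorem caterpillar_not_hasLeafLeafPath (hN : 1 < N) (hk0 : k 0 = 0) (hkN : k (N - 1) = 0)
    (hk : ∀ t, t ≠ 0 → t + 1 < N → k t ≠ 0) {l : ℕ} (hl : ∀ t < N, 2 * k t < l + 2)
    (hne : ∀ s t, s < t → t < N → k s + k t + (t - s) ≠ l) (hl0 : l ≠ 0) :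
    ¬ (caterpillar N k).HasLeafLeafPath l := by
  have hN0 : 0 < N := by omega
  rintro ⟨x, y, p, hx, hy, hp, hlen⟩
  have hT : (caterpillar N k).IsTree := ⟨caterpillar_connected hN0, caterpillar_isAcyclic⟩
  rw [hT.length_eq_dist hp] at hlen
  have hleaf : ∀ z, (caterpillar N k).IsLeafVertex z → z.1.2.size = k z.1.1 := by
    intro z hz
    rcases caterpillar_degree_eq hN hk0 hkN hk z with h | h
    · exact h.2
    · rw [IsLeafVertex, h] at hz
      omega
  have hxk := hleaf x hx
  have hyk := hleaf y hy
  have hxN := (mem_caterpillarVertices.1 x.2).1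
  have hyN := (mem_caterpillarVertices.1 y.2).1
  rcases lt_trichotomy x.1.1 y.1.1 with h | h | h
  · rw [caterpillar_dist_of_lt hN0 x y h, hxk, hyk] at hlen
    exact hne _ _ h hyN hlen
  · have h1 := caterpillar_dist_le_of_eq hN0 x y h (by rw [hxk, hyk, h])
    have := hl _ hxN
    rw [hxk] at h1
    omega
  · rw [dist_comm, caterpillar_dist_of_lt hN0 y x h, hxk, hyk] at hlen
    exact hne _ _ h hxN hlen

end Caterpillar

/-! ### The periodic height sequence avoiding length 20 -/

/-- One period of the heights of the binary trees in a caterpillar without leaf-leaf paths of length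
`20`. -/
def caterpillarPeriod : List ℕ :=
  [1, 2, 1, 4, 3, 2, 7, 6, 5, 6, 7, 2, 3, 4, 1, 2, 1, 8, 9, 6, 5, 6, 9, 8]

/-- The periodic sequence of heights, starting at position `1`, with trivial trees at the positions
`0` and `24 * n + 2`. -/
def caterpillarHeight (n t : ℕ) : ℕ :=
  if t = 0 ∨ t = 24 * n + 2 then 0 else caterpillarPeriod.getD ((t - 1) % 24) 0

theorem caterpillarPeriod_spec : ∀ r < 24, caterpillarPeriod.getD r 0 ≠ 0 ∧
    caterpillarPeriod.getD r 0 ≤ 10 ∧ (r + 1 + caterpillarPeriod.getD r 0) % 2 = 0 := by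
  decide

theorem caterpillarPeriod_add_ne : ∀ r < 24, ∀ d < 20, d ≠ 0 →
    caterpillarPeriod.getD r 0 + caterpillarPeriod.getD ((r + d) % 24) 0 + d ≠ 20 := by
  decide

/-- Gaps below 20 are a finite check modulo 24; for larger gaps the sum exceeds 20 because heights
are positive. -/
theorem caterpillarPeriod_add_ne_twenty {s t : ℕ} (hst : s < t) :
    caterpillarPeriod.getD (s % 24) 0 + caterpillarPeriod.getD (t % 24) 0 + (t - s) ≠ 20 := by
  have hs := (caterpillarPeriod_spec (s % 24) (Nat.mod_lt _ (by norm_num))).1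
  by_cases h : t - s < 20
  · have := caterpillarPeriod_add_ne (s % 24) (Nat.mod_lt _ (by norm_num)) (t - s) h (by omega)
    rwa [Nat.mod_add_mod, Nat.add_sub_cancel' hst.le] at this
  · omega

/-- Positions `1` and `24 * n + 1` have height 1. An end leaf of the spine is therefore as far from
every leaf over other positions as the leaf of the adjacent tree, which reduces the ends to the
periodic sequence. -/
theorem caterpillarHeight_add_ne (n s t : ℕ) (hst : s < t) (ht : t < 24 * n + 3) :
    caterpillarHeight n s + caterpillarHeight n t + (t - s) ≠ 20 := by
  have hfirst : caterpillarPeriod.getD 0 0 = 1 := rfl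
  have hsecond := caterpillarPeriod_spec ((t - 1) % 24) (Nat.mod_lt _ (by norm_num))
  unfold caterpillarHeight
  by_cases hs0 : s = 0
  · by_cases htn : t = 24 * n + 2
    · rw [if_pos (Or.inl hs0), if_pos (Or.inr htn)]
      omega
    · rw [if_pos (Or.inl hs0), if_neg (by omega)]
      by_cases ht1 : t = 1
      · subst ht1 hs0
        decide
      · have := caterpillarPeriod_add_ne_twenty (show 0 < t - 1 by omega)
        rw [Nat.zero_mod, hfirst] at this
        omega
  · rw [if_neg (show ¬ (s = 0 ∨ s = 24 * n + 2) by omega)]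
    by_cases htn : t = 24 * n + 2
    · rw [if_pos (Or.inr htn)]
      by_cases hs1 : s = 24 * n + 1
      · rw [show (s - 1) % 24 = 0 by omega, hfirst]
        omega
      · have := caterpillarPeriod_add_ne_twenty (show s - 1 < 24 * n by omega)
        rw [Nat.mul_mod_right, hfirst] at this
        omega
    · rw [if_neg (by omega)]
      have := caterpillarPeriod_add_ne_twenty (show s - 1 < t - 1 by omega)
      rwa [show t - 1 - (s - 1) = t - s by omega] at this

theorem caterpillarHeight_ne_zero (n t : ℕ) (ht : t ≠ 0) (htn : t + 1 < 24 * n + 3) :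
    caterpillarHeight n t ≠ 0 := by
  rw [caterpillarHeight, if_neg (by omega)]
  exact (caterpillarPeriod_spec _ (Nat.mod_lt _ (by norm_num))).1

theorem caterpillarHeight_le (n t : ℕ) : caterpillarHeight n t ≤ 10 := by
  unfold caterpillarHeight
  split_ifs
  · norm_num
  · exact (caterpillarPeriod_spec _ (Nat.mod_lt _ (by norm_num))).2.1

theorem even_add_caterpillarHeight (n t : ℕ) : Even (t + caterpillarHeight n t) := by
  rw [Nat.even_iff, caterpillarHeight]
  split_ifs with h
  · omega
  · have := (caterpillarPeriod_spec ((t - 1) % 24) (Nat.mod_lt _ (by norm_num))).2.2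
    omega

theorem card_caterpillarVertices_caterpillarHeight (n : ℕ) :
    (caterpillarVertices (24 * n + 3) (caterpillarHeight n)).card =
      (∑ t ∈ Finset.range (24 * n + 1), 2 ^ caterpillarPeriod.getD (t % 24) 0) + 2 := by
  rw [caterpillarVertices, Finset.card_sigma]
  simp only [Finset.card_range]
  rw [Finset.sum_range_succ, Finset.sum_range_succ']
  have h1 : caterpillarHeight n (24 * n + 2) = 0 := if_pos (Or.inr rfl)
  have h2 : caterpillarHeight n 0 = 0 := if_pos (Or.inl rfl)
  rw [h1, h2, pow_zero, add_assoc]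
  congr 1
  refine Finset.sum_congr rfl fun t ht => ?_
  rw [Finset.mem_range] at ht
  rw [caterpillarHeight, if_neg (by omega), Nat.add_sub_cancel]

theorem strictMono_card_caterpillarVertices : StrictMono fun n =>
    (caterpillarVertices (24 * n + 3) (caterpillarHeight n)).card := by
  refine strictMono_nat_of_lt_succ fun n => ?_
  simp only [card_caterpillarVertices_caterpillarHeight]
  refine Nat.add_lt_add_right ?_ 2
  rw [show 24 * (n + 1) + 1 = 24 * n + 24 + 1 by ring, Finset.sum_range_succ _ (24 * n + 24)]
  have hsub : Finset.range (24 * n + 1) ⊆ Finset.range (24 * n + 24) :=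
    Finset.range_subset_range.2 (by omega)
  have hpos : 0 < 2 ^ caterpillarPeriod.getD ((24 * n + 24) % 24) 0 := by positivity
  exact (Finset.sum_le_sum_of_subset hsub).trans_lt (Nat.lt_add_of_pos_right hpos)

/-! ### Assembly of the two halves -/

theorem mainTheorem2 :
    (∃ N₀ : ℕ, ∀ (V : Type*) [Fintype V] (T : SimpleGraph V) [DecidableRel T.Adj],
      T.IsEvenOneThreeTree → N₀ ≤ Fintype.card V →
        ∀ m : ℕ, m ≤ 9 → T.HasLeafLeafPath (2 * m)) ∧
    (∃ (order : ℕ → ℕ) (T : ∀ n : ℕ, SimpleGraph (Fin (order n)))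
        (_ : ∀ n : ℕ, DecidableRel (T n).Adj),
      StrictMono order ∧
        ∀ n : ℕ, (T n).IsEvenOneThreeTree ∧ ¬ (T n).HasLeafLeafPath 20) := by
  refine ⟨⟨4 ^ 60 + 1, fun V _ T _ hT hcard m hm => hT.hasLeafLeafPath hcard hm⟩, ?_⟩
  classical
  refine ⟨fun n => (caterpillarVertices (24 * n + 3) (caterpillarHeight n)).card,
    fun n => (caterpillar (24 * n + 3) (caterpillarHeight n)).overFin (Fintype.card_coe _),
    fun n => Classical.decRel _, strictMono_card_caterpillarVertices, fun n => ?_⟩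
  have hfirst : caterpillarHeight n 0 = 0 := if_pos (Or.inl rfl)
  have hlast : caterpillarHeight n (24 * n + 3 - 1) = 0 := if_pos (Or.inr rfl)
  let e := (caterpillar (24 * n + 3) (caterpillarHeight n)).overFinIso (Fintype.card_coe _)
  refine ⟨e.isEvenOneThreeTree (caterpillar_isEvenOneThreeTree (by omega) hfirst hlast
    (caterpillarHeight_ne_zero n) fun t _ => even_add_caterpillarHeight n t), fun h => ?_⟩
  refine caterpillar_not_hasLeafLeafPath (by omega) hfirst hlast (caterpillarHeight_ne_zero n)
    (fun t _ => ?_) (caterpillarHeight_add_ne n) (by norm_num) (e.symm.hasLeafLeafPath h)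
  have := caterpillarHeight_le n t
  omega
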